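/- Let $G$ be a locally compact (Hausdorff) group with a fixed left Haar measure $\mu$, and let $L^2(G)=L^2(G,\mu)$. For a unitary representation $\pi:G\to\mathcal U(\mathcal H_\pi)$ on a complex Hilbert space (a group homomorphism for which all functions $x\mapsto\langle f,\pi(x)g\rangle$ are continuous) and $f,g\in\mathcal H_\pi$, write $\mathcal W_g f(x):=\langle f,\pi(x)g\rangle$, $x\in G$. A non-zero vector $g\in\mathcal H_\pi$ is square integrable if $\mathcal W_g g\in L^2(G)$, and $\pi$ is square integrable if it is irreducible and has a square integrable vector. A square integrable vector $g$ is admissible if $\|\mathcal W_g g\|_{L^2(G)}=\|g\|_{\mathcal H_\pi}$ (equivalently, $\|C_\pi g\|=1$, where $C_\pi$ is the Duflo–Moore operator of $\pi$). A function $F:G\to\mathbb C$ is of positive type if for every finite subset $\{x_1,\dots,x_m\}\subset G$ the matrix $\{F(x_j^{-1}x_i)\}_{i,j=1}^m$ is (Hermitian) positive semi-definite. Let $\pi:G\to\mathcal U(\mathcal H_\pi)$ and $\rho:G\to\mathcal U(\mathcal H_\rho)$ be square integrable representations with admissible vectors $g\in\mathcal H_\pi$ and $h\in\mathcal H_\rho$,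 respectively. Then $\mathcal W_g g-\mathcal W_h h$ is never a non-zero function of positive type; that is, if $\mathcal W_g g-\mathcal W_h h$ is of positive type, then $\mathcal W_g g=\mathcal W_h h$ on $G$. -/

import Mathlib

open MeasureTheory
open scoped ComplexOrder

namespace WaveletSpaces

noncomputable section

variable {G : Type*} [Group G]
variable {H : Type*} [NormedAddCommGroup H] [InnerProductSpace ℂ H] [CompleteSpace H]

/-- The wavelet transform `(W_g f)(x) = ⟨f, π(x) g⟩`, where the bracket is linear in its first
argument. Mathlib's `inner ℂ` is linear in its second argument, hence the order below. -/
def waveletTransform (π : G →* unitary (H →L[ℂ] H)) (g f : H) (x : G) : ℂ :=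
  inner ℂ ((π x : H →L[ℂ] H) g) f

/-- A homomorphism `π` into the unitary operators is a unitary representation if all the functions
`x ↦ ⟨f, π(x) g⟩` are continuous. -/
def IsUnitaryRepresentation [TopologicalSpace G] (π : G →* unitary (H →L[ℂ] H)) : Prop :=
  ∀ f g : H, Continuous (waveletTransform π g f)

/-- `π` is irreducible: the only closed invariant subspaces are the trivial ones. -/
def IsIrreducible (π : G →* unitary (H →L[ℂ] H)) : Prop :=
  ∀ M : Submodule ℂ H, IsClosed (M : Set H) →
    (∀ x : G, ∀ v ∈ M, (π x : H →L[ℂ] H) v ∈ M) → M = ⊥ ∨ M = ⊤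

/-- A non-zero vector `g` is square integrable if `W_g g ∈ L²(G)`. -/
def IsSquareIntegrableVector [MeasurableSpace G] (μ : Measure G)
    (π : G →* unitary (H →L[ℂ] H)) (g : H) : Prop :=
  g ≠ 0 ∧ MemLp (waveletTransform π g g) 2 μ

/-- A square integrable representation: an irreducible unitary representation that has a
square integrable vector. -/
structure IsSquareIntegrableRepresentation [TopologicalSpace G] [MeasurableSpace G]
    (μ : Measure G) (π : G →* unitary (H →L[ℂ] H)) : Prop where
  isUnitaryRepresentation : IsUnitaryRepresentation π
  isIrreducible : IsIrreducible π
  exists_vector : ∃ g : H, IsSquareIntegrableVector μ π g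

/-- A square integrable vector `g` is admissible if `‖C g‖ = 1`, where `C` is the Duflo-Moore
operator of `π`. The orthogonality relations that determine `C` say that
`‖W_g g‖ = ‖g‖ * ‖C g‖`, the norm on the left being that of `L²(G)`; so the condition is
`‖W_g g‖ = ‖g‖`. It is stated in this form, which presupposes neither the existence of `C` nor the
orthogonality relations; see `isAdmissible_iff_norm_dufloMoore_eq_one` for the equivalence. -/
def IsAdmissible [MeasurableSpace G] (μ : Measure G)
    (π : G →* unitary (H →L[ℂ] H)) (g : H) : Prop :=
  IsSquareIntegrableVector μ π g ∧ eLpNorm (waveletTransform π g g) 2 μ = ‖g‖ₑ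

/-- For every operator `C` with the two defining properties of the Duflo-Moore operator (its
domain consists of `0` and the square integrable vectors, and the orthogonality relations hold),
a vector `g` is admissible if and only if it is a square integrable vector with `‖C g‖ = 1`. -/
theorem isAdmissible_iff_norm_dufloMoore_eq_one [MeasurableSpace G] (μ : Measure G)
    (π : G →* unitary (H →L[ℂ] H)) (C : H →ₗ.[ℂ] H)
    (hdom : ∀ g : H, g ≠ 0 → (IsSquareIntegrableVector μ π g ↔ g ∈ C.domain))
    (horth : ∀ (g₁ g₂ : C.domain) (f₁ f₂ : H),
      ∫ x, waveletTransform π (g₁ : H) f₁ x *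
          (starRingEnd ℂ) (waveletTransform π (g₂ : H) f₂ x) ∂μ =
        inner ℂ f₂ f₁ * (starRingEnd ℂ) (inner ℂ (C g₂) (C g₁)))
    (g : H) :
    IsAdmissible μ π g ↔
      IsSquareIntegrableVector μ π g ∧ ∃ hg : g ∈ C.domain, ‖C ⟨g, hg⟩‖ = 1 := by
  unfold IsAdmissible
  refine and_congr_right fun hsq => ?_
  have hg : g ∈ C.domain := (hdom g hsq.1).1 hsq
  have hpos : 0 < ‖g‖ := norm_pos_iff.2 hsq.1
  have h1 := horth ⟨g, hg⟩ ⟨g, hg⟩ g g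
  have h2 : (∫ x, ‖waveletTransform π g g x‖ ^ 2 ∂μ) = ‖g‖ ^ 2 * ‖C ⟨g, hg⟩‖ ^ 2 := by
    have h3 : ∀ x, waveletTransform π g g x * (starRingEnd ℂ) (waveletTransform π g g x) =
        ((‖waveletTransform π g g x‖ ^ 2 : ℝ) : ℂ) := by
      intro x
      rw [Complex.mul_conj, Complex.normSq_eq_norm_sq]
    simp only [h3, integral_complex_ofReal, inner_self_eq_norm_sq_to_K] at h1
    simp only [map_pow, Complex.coe_algebraMap, Complex.conj_ofReal] at h1
    exact_mod_cast h1
  have h4 : eLpNorm (waveletTransform π g g) 2 μ =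
      ENNReal.ofReal (‖g‖ * ‖C ⟨g, hg⟩‖) := by
    rw [hsq.2.eLpNorm_eq_integral_rpow_norm (by norm_num) (by norm_num)]
    congr 1
    simp only [ENNReal.toReal_ofNat, Real.rpow_two]
    rw [h2, ← mul_pow, ← Real.rpow_natCast, ← Real.rpow_mul (by positivity)]
    norm_num
  rw [h4, ← ofReal_norm, ENNReal.ofReal_eq_ofReal_iff (by positivity) (by positivity)]
  constructor
  · intro h
    exact ⟨hg, mul_left_cancel₀ hpos.ne' (by simpa using h)⟩
  · rintro ⟨_, h⟩
    rw [h, mul_one]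

/-- `f : G → ℂ` is of positive type if for every finite subset `Ω` of `G` the matrix
`(f (y⁻¹ * x))`, with rows `x ∈ Ω` and columns `y ∈ Ω`, is positive semi-definite. -/
def IsPositiveType (f : G → ℂ) : Prop :=
  ∀ Ω : Finset G, (Matrix.of fun x y : Ω => f ((y : G)⁻¹ * (x : G))).PosSemidef

end

end WaveletSpaces

/-!
Write `φ = W_g g` and `ψ = W_h h`. If `φ - ψ` is of positive type, then
`‖∑ cₓ ρ(x) h‖ ≤ ‖∑ cₓ π(x) g‖` for all finitely supported coefficients `c`, since the difference of
the squares of the two sides is the value at `c` of the quadratic form attached to `φ - ψ`. As `π` is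
irreducible, the orbit of `g` spans a dense subspace, so `π(x) g ↦ ρ(x) h` extends to a bounded
operator `T` that intertwines `π` and `ρ` and maps `g` to `h`
(`exists_intertwiner_of_isPositiveType_sub`). The positive operator `T⋆ T` commutes with `π`, so by
Schur's lemma (`exists_eq_algebraMap_of_commute`) it is a real scalar `c`, whence
`ψ x = ⟪T π(x) g, T g⟫ = c * φ x`.

It remains to compare two normalizations. Evaluation at `1` gives `‖h‖² = c ‖g‖²`, while
admissibility of `g` and `h` turns the `L²` norm of `ψ = c φ` into `‖h‖ = |c| ‖g‖`. Since `g` and `h`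
are non-zero, `c = 1`. The Duflo-Moore operators and the orthogonality relations do not enter.
-/

namespace WaveletSpaces

variable {G : Type*} [Group G]
variable {H : Type*} [NormedAddCommGroup H] [InnerProductSpace ℂ H] [CompleteSpace H]
variable {K : Type*} [NormedAddCommGroup K] [InnerProductSpace ℂ K] [CompleteSpace K]

theorem map_mul_apply (π : G →* unitary (H →L[ℂ] H)) (x y : G) (v : H) :
    (π (x * y) : H →L[ℂ] H) v = (π x : H →L[ℂ] H) ((π y : H →L[ℂ] H) v) := by
  simp

theorem inner_apply_left (π : G →* unitary (H →L[ℂ] H)) (x : G) (v w : H) :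
    inner ℂ ((π x : H →L[ℂ] H) v) w = inner ℂ v ((π x⁻¹ : H →L[ℂ] H) w) := by
  have h1 := (π x : H →L[ℂ] H).inner_map_map_of_mem_unitary (π x).2 v ((π x⁻¹ : H →L[ℂ] H) w)
  rw [← map_mul_apply] at h1
  simpa using h1

/-- Schur's lemma for self-adjoint operators: on an irreducible unitary representation, such an
operator is a real scalar if it commutes with the representation. -/
theorem exists_eq_algebraMap_of_commute [Nontrivial H] {π : G →* unitary (H →L[ℂ] H)}
    (hπ : IsIrreducible π) {A : H →L[ℂ] H} (hA : IsSelfAdjoint A)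
    (hcomm : ∀ x, Commute A (π x : H →L[ℂ] H)) : ∃ c : ℝ, A = algebraMap ℝ (H →L[ℂ] H) c := by
  obtain ⟨a, ha⟩ := ContinuousFunctionalCalculus.spectrum_nonempty (R := ℝ) A hA
  refine ⟨a, CFC.eq_algebraMap_of_spectrum_subset_singleton A a ?_⟩
  -- Two points of the spectrum are separated by continuous functions `f₁`, `f₂` with `f₁ * f₂ = 0`.
  -- The kernel of `f₁ A` is then invariant, and it is neither `0` nor the whole space.
  have key : ∀ s ∈ spectrum ℝ A, ∀ t ∈ spectrum ℝ A, ¬ s < t := by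
    intro s hs t ht hst
    set f₁ : ℝ → ℝ := fun r => max (r - (s + t) / 2) 0 with hf₁
    set f₂ : ℝ → ℝ := fun r => max ((s + t) / 2 - r) 0 with hf₂
    have c₁ : Continuous f₁ := by fun_prop
    have c₂ : Continuous f₂ := by fun_prop
    have hmul : cfc f₁ A * cfc f₂ A = 0 := by
      rw [← cfc_mul f₁ f₂ A c₁.continuousOn c₂.continuousOn]
      have h0 : (fun r => f₁ r * f₂ r) = fun _ => 0 := by
        funext r
        rcases le_total r ((s + t) / 2) with h | h
        · simp [hf₁, h]
        · simp [hf₂, h]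
      rw [h0, cfc_const_zero]
    have ne_zero : ∀ f : ℝ → ℝ, Continuous f → ∀ r ∈ spectrum ℝ A, f r ≠ 0 → cfc f A ≠ 0 := by
      intro f hf r hr hfr h0
      have h1 : f r ∈ spectrum ℝ (cfc f A) := by
        rw [cfc_map_spectrum f A hA hf.continuousOn]
        exact ⟨r, hr, rfl⟩
      rw [h0, spectrum.zero_eq] at h1
      exact hfr h1
    have n₁ : cfc f₁ A ≠ 0 := ne_zero f₁ c₁ t ht (lt_max_of_lt_left (by linarith)).ne'
    have n₂ : cfc f₂ A ≠ 0 := ne_zero f₂ c₂ s hs (lt_max_of_lt_left (by linarith)).ne'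
    have hinv : ∀ x, ∀ v ∈ LinearMap.ker (cfc f₁ A : H →L[ℂ] H).toLinearMap,
        (π x : H →L[ℂ] H) v ∈ LinearMap.ker (cfc f₁ A : H →L[ℂ] H).toLinearMap := by
      intro x v hv
      have h1 := DFunLike.congr_fun ((hcomm x).cfc_real f₁).eq v
      simp only [LinearMap.mem_ker, ContinuousLinearMap.coe_coe] at hv ⊢
      simpa [hv] using h1
    rcases hπ _ (cfc f₁ A).isClosed_ker hinv with h | h
    · apply n₂
      ext v
      have hv : cfc f₂ A v ∈ LinearMap.ker (cfc f₁ A : H →L[ℂ] H).toLinearMap := by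
        simpa using DFunLike.congr_fun hmul v
      rw [h] at hv
      simpa using hv
    · apply n₁
      ext v
      have hv : v ∈ LinearMap.ker (cfc f₁ A : H →L[ℂ] H).toLinearMap := by
        rw [h]
        exact Submodule.mem_top
      simpa using hv
  intro b hb
  rcases lt_trichotomy a b with h | h | h
  · exact (key a ha b hb h).elim
  · exact h.symm
  · exact (key b hb a ha h).elim

theorem dense_span_orbit {π : G →* unitary (H →L[ℂ] H)} (hπ : IsIrreducible π) {g : H}
    (hg : g ≠ 0) :
    Dense (Submodule.span ℂ (Set.range fun x => (π x : H →L[ℂ] H) g) : Set H) := by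
  set S := Submodule.span ℂ (Set.range fun x => (π x : H →L[ℂ] H) g) with hS
  rw [Submodule.dense_iff_topologicalClosure_eq_top]
  refine (hπ S.topologicalClosure S.isClosed_topologicalClosure ?_).resolve_left ?_
  · intro x v hv
    have hmap : Set.MapsTo (π x : H →L[ℂ] H) S S := by
      intro v hv
      have hle : S ≤ S.comap (π x : H →L[ℂ] H).toLinearMap := by
        rw [hS, Submodule.span_le]
        rintro _ ⟨y, rfl⟩
        refine Submodule.subset_span ⟨x * y, ?_⟩
        exact map_mul_apply π x y g
      exact hle hv
    exact hmap.closure (π x : H →L[ℂ] H).continuous hv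
  · intro h
    have hg' : g ∈ S.topologicalClosure :=
      S.le_topologicalClosure (Submodule.subset_span ⟨1, by simp⟩)
    rw [h] at hg'
    exact hg (by simpa using hg')

theorem of_waveletTransform_eq_gram (π : G →* unitary (H →L[ℂ] H)) (g : H) (Ω : Finset G) :
    (Matrix.of fun x y : Ω => waveletTransform π g g ((y : G)⁻¹ * (x : G))) =
      Matrix.gram ℂ fun x : Ω => (π x : H →L[ℂ] H) g := by
  ext x y
  simp only [Matrix.of_apply, Matrix.gram_apply, waveletTransform, map_mul_apply]
  rw [inner_apply_left, inv_inv]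

theorem norm_linearCombination_le_of_isPositiveType_sub {π : G →* unitary (H →L[ℂ] H)}
    {ρ : G →* unitary (K →L[ℂ] K)} {g : H} {h : K}
    (hpos : IsPositiveType (waveletTransform π g g - waveletTransform ρ h h)) (c : G →₀ ℂ) :
    ‖Finsupp.linearCombination ℂ (fun x => (ρ x : K →L[ℂ] K) h) c‖ ≤
      ‖Finsupp.linearCombination ℂ (fun x => (π x : H →L[ℂ] H) g) c‖ := by
  have h1 := (hpos c.support).dotProduct_mulVec_nonneg fun x => c x
  have h2 : (Matrix.of fun x y : c.support =>
      (waveletTransform π g g - waveletTransform ρ h h) ((y : G)⁻¹ * (x : G))) =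
      Matrix.gram ℂ (fun x : c.support => (π x : H →L[ℂ] H) g) -
        Matrix.gram ℂ fun x : c.support => (ρ x : K →L[ℂ] K) h := by
    rw [← of_waveletTransform_eq_gram, ← of_waveletTransform_eq_gram]
    rfl
  rw [h2, Matrix.sub_mulVec, dotProduct_sub, Matrix.star_dotProduct_gram_mulVec,
    Matrix.star_dotProduct_gram_mulVec,
    Finset.sum_coe_sort c.support fun x => c x • (π x : H →L[ℂ] H) g,
    Finset.sum_coe_sort c.support fun x => c x • (ρ x : K →L[ℂ] K) h,
    inner_self_eq_norm_sq_to_K, inner_self_eq_norm_sq_to_K, sub_nonneg] at h1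
  rw [Finsupp.linearCombination_apply, Finsupp.linearCombination_apply, Finsupp.sum, Finsupp.sum]
  refine le_of_sq_le_sq ?_ (norm_nonneg _)
  exact_mod_cast h1

theorem exists_intertwiner_of_isPositiveType_sub {π : G →* unitary (H →L[ℂ] H)}
    {ρ : G →* unitary (K →L[ℂ] K)} (hπ : IsIrreducible π) {g : H} (hg : g ≠ 0) {h : K}
    (hpos : IsPositiveType (waveletTransform π g g - waveletTransform ρ h h)) :
    ∃ T : H →L[ℂ] K, T g = h ∧
      ∀ x v, T ((π x : H →L[ℂ] H) v) = (ρ x : K →L[ℂ] K) (T v) := by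
  set P := Finsupp.linearCombination ℂ (fun x => (π x : H →L[ℂ] H) g) with hP
  set R := Finsupp.linearCombination ℂ (fun x => (ρ x : K →L[ℂ] K) h) with hR
  have hspan := dense_span_orbit hπ hg
  have hdense : DenseRange P := by
    rw [← Finsupp.range_linearCombination] at hspan
    exact hspan
  set T : H →L[ℂ] K := R.extendOfNorm P
  have hT : ∀ x, T ((π x : H →L[ℂ] H) g) = (ρ x : K →L[ℂ] K) h := by
    intro x
    have h1 := LinearMap.extendOfNorm_eq (f := R) hdense
      ⟨1, fun c => by simpa using norm_linearCombination_le_of_isPositiveType_sub hpos c⟩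
      (Finsupp.single x 1)
    simpa [hP, hR] using h1
  refine ⟨T, by simpa using hT 1, fun x v => ?_⟩
  have h2 : T ∘L (π x : H →L[ℂ] H) = (ρ x : K →L[ℂ] K) ∘L T := by
    refine ContinuousLinearMap.ext_on hspan ?_
    rintro _ ⟨y, rfl⟩
    simp only [ContinuousLinearMap.comp_apply]
    rw [← map_mul_apply, hT, hT, map_mul_apply]
  exact DFunLike.congr_fun h2 v

/-- A diagonal coefficient dominated, in the order given by functions of positive type, by a
diagonal coefficient of an irreducible representation is a scalar multiple of it. -/
theorem exists_waveletTransform_eq_smul {π : G →* unitary (H →L[ℂ] H)}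
    {ρ : G →* unitary (K →L[ℂ] K)} (hπ : IsIrreducible π) {g : H} (hg : g ≠ 0) {h : K}
    (hpos : IsPositiveType (waveletTransform π g g - waveletTransform ρ h h)) :
    ∃ c : ℝ, waveletTransform ρ h h = c • waveletTransform π g g := by
  obtain ⟨T, rfl, hT⟩ := exists_intertwiner_of_isPositiveType_sub hπ hg hpos
  have : Nontrivial H := ⟨g, 0, hg⟩
  obtain ⟨c, hc⟩ := exists_eq_algebraMap_of_commute hπ
    (A := ContinuousLinearMap.adjoint T ∘L T) (ContinuousLinearMap.isPositive_adjoint_comp_self T).isSelfAdjoint (by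
      intro x
      ext v
      refine ext_inner_right ℂ fun w => ?_
      simp only [mul_apply_eq_comp, ContinuousLinearMap.comp_apply]
      rw [ContinuousLinearMap.adjoint_inner_left, hT, inner_apply_left, inner_apply_left,
        ContinuousLinearMap.adjoint_inner_left, hT])
  refine ⟨c, funext fun x => ?_⟩
  have h1 : ContinuousLinearMap.adjoint T (T g) = c • g := by
    simpa [Algebra.algebraMap_eq_smul_one] using DFunLike.congr_fun hc g
  simp only [waveletTransform, Pi.smul_apply]
  rw [← hT, ← ContinuousLinearMap.adjoint_inner_right, h1, inner_smul_right_eq_smul]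

theorem waveletTransform_self_one (π : G →* unitary (H →L[ℂ] H)) (g : H) :
    waveletTransform π g g 1 = ((‖g‖ ^ 2 : ℝ) : ℂ) := by
  simp [waveletTransform, inner_self_eq_norm_sq_to_K]

end WaveletSpaces

theorem corollary4p6
    {G : Type*} [Group G] [TopologicalSpace G] [IsTopologicalGroup G] [T2Space G]
    [LocallyCompactSpace G] [MeasurableSpace G] [BorelSpace G]
    (μ : MeasureTheory.Measure G) [μ.IsHaarMeasure] [μ.Regular]
    {Hπ : Type*} [NormedAddCommGroup Hπ] [InnerProductSpace ℂ Hπ] [CompleteSpace Hπ]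
    {Hρ : Type*} [NormedAddCommGroup Hρ] [InnerProductSpace ℂ Hρ] [CompleteSpace Hρ]
    (π : G →* unitary (Hπ →L[ℂ] Hπ)) (ρ : G →* unitary (Hρ →L[ℂ] Hρ))
    (hπ : WaveletSpaces.IsSquareIntegrableRepresentation μ π)
    (hρ : WaveletSpaces.IsSquareIntegrableRepresentation μ ρ)
    (g : Hπ) (hg : WaveletSpaces.IsAdmissible μ π g)
    (h : Hρ) (hh : WaveletSpaces.IsAdmissible μ ρ h) :
    ¬ (WaveletSpaces.waveletTransform π g g - WaveletSpaces.waveletTransform ρ h h ≠ 0 ∧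
      WaveletSpaces.IsPositiveType
        (WaveletSpaces.waveletTransform π g g - WaveletSpaces.waveletTransform ρ h h)) := by
  rintro ⟨hne, hpos⟩
  obtain ⟨c, hc⟩ := WaveletSpaces.exists_waveletTransform_eq_smul hπ.isIrreducible hg.1.1 hpos
  have hg0 : 0 < ‖g‖ := norm_pos_iff.2 hg.1.1
  have hh0 : 0 < ‖h‖ := norm_pos_iff.2 hh.1.1
  have hone : ‖h‖ ^ 2 = c * ‖g‖ ^ 2 := by
    have h1 := congrFun hc 1
    rw [Pi.smul_apply, WaveletSpaces.waveletTransform_self_one,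
      WaveletSpaces.waveletTransform_self_one, Complex.real_smul] at h1
    exact_mod_cast h1
  have hc0 : 0 < c := by
    have h1 : 0 < c * ‖g‖ ^ 2 := by
      rw [← hone]
      positivity
    exact pos_of_mul_pos_left h1 (by positivity)
  have hnorm : ‖h‖ = c * ‖g‖ := by
    have h1 := hh.2
    rw [hc, MeasureTheory.eLpNorm_const_smul, hg.2, ← enorm_norm g, ← enorm_norm h,
      ← enorm_mul] at h1
    have h2 := congrArg ENNReal.toReal h1
    simpa [abs_of_pos hc0] using h2.symm
  have hc1 : c = 1 := by
    rw [hnorm] at hone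
    have h1 : c * ‖g‖ ^ 2 * (c - 1) = 0 := by linear_combination hone
    rcases mul_eq_zero.1 h1 with h2 | h2
    · exact absurd h2 (by positivity)
    · exact sub_eq_zero.1 h2
  exact hne (by rw [hc, hc1, one_smul, sub_self])
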